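/- Let $(X,\mathcal F,\mu)$ be a measure space and let $\mathcal A\subseteq\mathcal F$ be a $\sigma$-subalgebra such that $(X,\mathcal A,\mu|_{\mathcal A})$ is $\sigma$-finite. Let $E=E^{\mathcal A}$ be the conditional expectation with respect to $\mathcal A$, defined for nonnegative $\mathcal F$-measurable functions and, by linearity, for all complex $\mathcal F$-measurable $g$ with $E(|g|)<\infty$ a.e. Let $w,u\ge 0$ be real-valued $\mathcal F$-measurable functions on $X$ with $E(u^2)\in L^\infty(\mathcal A)$, and suppose that $T=M_wEM_u$, $Tf=wE(uf)$, is a bounded operator on the complex Hilbert space $L^2(\mathcal F)$. For a bounded operator $S$ on a complex Hilbert space $\mathcal H$ let $r(S)$ be its spectral radius and, for integers $m\ge1$, put $$d_m=\frac1{\frac1m+r(S)},\qquad R_m(S)=\Bigl(\sum_{n=0}^\infty d_m^{2n}\,S^{*n}S^n\Bigr)^{1/2},$$ and let the spectral radius algebra of $S$ be $$\mathcal B_S=\{Q\in\mathcal B(\mathcal H):\ \sup_{m\ge1}\|R_m(S)\,Q\,R_m(S)^{-1}\|<\infty\}.$$ Let $\widetilde S=|S|^{1/2}U|S|^{1/2}$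 be the Aluthge transform of $S$, where $S=U|S|$ is the polar decomposition ($|S|=(S^*S)^{1/2}$, $U$ the partial isometry with $\ker U=\ker|S|$). If $T=0$ or $r(T)>0$, then $\mathcal B_T=\mathcal B_{\widetilde T}$. -/

import Mathlib

open MeasureTheory
open scoped ENNReal

noncomputable section

namespace WCE

/-! ### Polar decomposition, Aluthge transform and spectral radius algebra -/

section Operators

variable {H : Type*} [NormedAddCommGroup H] [InnerProductSpace ℂ H] [CompleteSpace H]

/-- `U` is the partial isometry of the polar decomposition `T = U|T|`, where
`|T| = (T*T)^{1/2}`: it is isometric on the orthogonal complement of its kernel,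
`T = U|T|`, and `ker U = ker |T|`. -/
structure IsPolarPart (T U : H →L[ℂ] H) : Prop where
  partial_isometry : ∀ x ∈ (LinearMap.ker (U : H →ₗ[ℂ] H))ᗮ, ‖U x‖ = ‖x‖
  eq_mul : T = U * CFC.abs T
  ker_eq : LinearMap.ker (U : H →ₗ[ℂ] H) = LinearMap.ker ((CFC.abs T : H →L[ℂ] H) : H →ₗ[ℂ] H)

theorem norm_abs_apply (T : H →L[ℂ] H) (x : H) : ‖CFC.abs T x‖ = ‖T x‖ := by
  have hsa : ContinuousLinearMap.adjoint (CFC.abs T) = CFC.abs T :=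
    (IsSelfAdjoint.of_nonneg (CFC.abs_nonneg T)).adjoint_eq
  have h : CFC.abs T (CFC.abs T x) = ContinuousLinearMap.adjoint T (T x) := by
    have := congrArg (fun S : H →L[ℂ] H => S x) (CFC.abs_mul_abs T)
    simpa [ContinuousLinearMap.star_eq_adjoint] using this
  have h2 : inner ℂ (CFC.abs T x) (CFC.abs T x) = inner ℂ (T x) (T x) := by
    rw [← ContinuousLinearMap.adjoint_inner_left, hsa, h,
      ContinuousLinearMap.adjoint_inner_left]
  rw [inner_self_eq_norm_sq_to_K, inner_self_eq_norm_sq_to_K] at h2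
  have h3 : ‖CFC.abs T x‖ ^ 2 = ‖T x‖ ^ 2 := by exact_mod_cast h2
  exact (pow_left_inj₀ (norm_nonneg _) (norm_nonneg _) two_ne_zero).1 h3

theorem ker_abs_eq (T : H →L[ℂ] H) :
    LinearMap.ker ((CFC.abs T : H →L[ℂ] H) : H →ₗ[ℂ] H) = (LinearMap.range ((CFC.abs T : H →L[ℂ] H) : H →ₗ[ℂ] H))ᗮ := by
  have hsa : ContinuousLinearMap.adjoint (CFC.abs T) = CFC.abs T :=
    (IsSelfAdjoint.of_nonneg (CFC.abs_nonneg T)).adjoint_eq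
  have := ContinuousLinearMap.orthogonal_range (CFC.abs T)
  rw [hsa] at this
  exact this.symm

/-- Every bounded operator on a Hilbert space has exactly one polar decomposition. -/
theorem existsUnique_isPolarPart (T : H →L[ℂ] H) : ∃! U : H →L[ℂ] H, IsPolarPart T U := by
  set A : H →L[ℂ] H := CFC.abs T with hA
  set K : Submodule ℂ H := (LinearMap.range (A : H →ₗ[ℂ] H)).topologicalClosure with hK
  have hKc : IsClosed (K : Set H) := Submodule.isClosed_topologicalClosure _
  have : CompleteSpace K := hKc.completeSpace_coe
  have hmem : ∀ x, (A : H →ₗ[ℂ] H) x ∈ K := fun x =>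
    Submodule.le_topologicalClosure _ (LinearMap.mem_range_self _ x)
  have hker : LinearMap.ker (A : H →ₗ[ℂ] H) = Kᗮ := by
    rw [hK, Submodule.orthogonal_closure]
    exact ker_abs_eq T
  have hclos : ∀ k ∈ K, k ∈ closure (Set.range A) := by
    intro k hk
    have : k ∈ closure ((LinearMap.range (A : H →ₗ[ℂ] H) : Submodule ℂ H) : Set H) := by
      rw [hK] at hk
      simpa [← Submodule.topologicalClosure_coe] using hk
    exact this
  refine existsUnique_of_exists_of_unique ?_ ?_
  · let e : H →ₗ[ℂ] K := LinearMap.codRestrict K (A : H →ₗ[ℂ] H) hmem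
    have he : DenseRange e := by
      intro k
      rw [closure_subtype]
      have := hclos k k.2
      convert this using 2
      ext y
      constructor
      · rintro ⟨_, ⟨x, rfl⟩, rfl⟩; exact ⟨x, rfl⟩
      · rintro ⟨x, rfl⟩; exact ⟨e x, ⟨x, rfl⟩, rfl⟩
    have hnorm : ∀ x, ‖(T : H →ₗ[ℂ] H) x‖ = ‖e x‖ := fun x => (norm_abs_apply T x).symm
    let V : K →L[ℂ] H := (T : H →ₗ[ℂ] H).extendOfNorm e
    have hV : ∀ x, V (e x) = T x := fun x =>
      LinearMap.extendOfNorm_eq he ⟨1, fun x => by rw [one_mul, hnorm]⟩ x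
    have hVn : ∀ k, ‖V k‖ = ‖k‖ := by
      intro k
      refine he.induction_on (p := fun k => ‖V k‖ = ‖k‖) k ?_ ?_
      · exact isClosed_eq (by fun_prop) (by fun_prop)
      · intro x
        rw [hV]; exact hnorm x
    let U : H →L[ℂ] H := V ∘L K.orthogonalProjectionOnto
    have hUker : LinearMap.ker (U : H →ₗ[ℂ] H) = Kᗮ := by
      ext x
      rw [LinearMap.mem_ker, ← Submodule.orthogonalProjectionOnto_eq_zero_iff]
      change V (K.orthogonalProjectionOnto x) = 0 ↔ _
      rw [← norm_eq_zero, hVn, norm_eq_zero]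
    refine ⟨U, ?_, ?_, ?_⟩
    · intro x hx
      rw [hUker, Submodule.orthogonal_orthogonal] at hx
      change ‖V (K.orthogonalProjectionOnto x)‖ = _
      rw [hVn, Submodule.orthogonalProjectionOnto_mem_subspace_eq_self (⟨x, hx⟩ : K)]
      rfl
    · ext x
      change T x = V (K.orthogonalProjectionOnto (A x))
      have : K.orthogonalProjectionOnto (A x) = e x :=
        Submodule.orthogonalProjectionOnto_mem_subspace_eq_self (e x)
      rw [this, hV]
    · rw [hUker, ← hker]
  · intro U₁ U₂ h₁ h₂
    have hfix : ∀ k ∈ K, U₁ k = U₂ k := by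
      intro k hk
      have hsub : closure (Set.range A) ⊆ {k | U₁ k = U₂ k} := by
        refine closure_minimal ?_ (isClosed_eq U₁.continuous U₂.continuous)
        rintro _ ⟨x, rfl⟩
        have e1 : T x = U₁ (A x) := congrArg (fun S : H →L[ℂ] H => S x) h₁.eq_mul
        have e2 : T x = U₂ (A x) := congrArg (fun S : H →L[ℂ] H => S x) h₂.eq_mul
        exact e1.symm.trans e2
      exact hsub (hclos k hk)
    have hz : ∀ U : H →L[ℂ] H, IsPolarPart T U → ∀ z ∈ Kᗮ, U z = 0 := by
      intro U hU z hz
      rw [← hker, hA, ← hU.ker_eq] at hz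
      exact hz
    ext x
    obtain ⟨y, hy, z, hz', rfl⟩ := K.exists_add_mem_mem_orthogonal (v := x)
    rw [map_add, map_add, hfix y hy, hz U₁ h₁ z hz', hz U₂ h₂ z hz']

/-- The partial isometry `U` in the polar decomposition `T = U|T|`. -/
def polarPart (T : H →L[ℂ] H) : H →L[ℂ] H := (existsUnique_isPolarPart T).choose

theorem isPolarPart_polarPart (T : H →L[ℂ] H) : IsPolarPart T (polarPart T) :=
  (existsUnique_isPolarPart T).choose_spec.1

/-- The Aluthge transform `|T|^{1/2} U |T|^{1/2}`. -/
def aluthge (T : H →L[ℂ] H) : H →L[ℂ] H :=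
  CFC.sqrt (CFC.abs T) * polarPart T * CFC.sqrt (CFC.abs T)

/-- `d_m = 1 / (1/m + r(T))`, with `r(T)` the spectral radius. -/
def dCoeff (T : H →L[ℂ] H) (m : ℕ) : ℝ :=
  1 / (1 / (m : ℝ) + (spectralRadius ℂ T).toReal)

/-- `R_m(T) = (∑ₙ d_m^{2n} (T*)ⁿ Tⁿ)^{1/2}`; for `m ≥ 1` the series converges in norm. -/
def rOp (T : H →L[ℂ] H) (m : ℕ) : H →L[ℂ] H :=
  CFC.sqrt (∑' n : ℕ, ((dCoeff T m ^ (2 * n) : ℝ) : ℂ) • (star T ^ n * T ^ n))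

/-- The spectral radius algebra `B_T`: all bounded `S` with
`sup_{m ≥ 1} ‖R_m S R_m⁻¹‖ < ∞`. -/
def spectralRadiusAlgebra (T : H →L[ℂ] H) : Set (H →L[ℂ] H) :=
  {S | ∃ C : ℝ, ∀ m : ℕ, 1 ≤ m → ‖rOp T m * S * Ring.inverse (rOp T m)‖ ≤ C}

end Operators

/-! ### Weighted conditional expectation operators -/

section CondExp

variable {X : Type*}

/-- Conditional expectation of a real function `g`, as `E(g⁺) - E(g⁻)`, where `E` on
nonnegative functions is the Lebesgue conditional expectation. This makes sense for every `g`
with `E|g| < ∞` a.e.; `g` need not be integrable. -/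
def condER (𝒜 : MeasurableSpace X) {mX : MeasurableSpace X} (μ : Measure X) (g : X → ℝ) (x : X) : ℝ :=
  (condLExp 𝒜 μ (fun y => ENNReal.ofReal (g y)) x).toReal -
    (condLExp 𝒜 μ (fun y => ENNReal.ofReal (-g y)) x).toReal

/-- Conditional expectation of a complex function, through real and imaginary parts. -/
def condE (𝒜 : MeasurableSpace X) {mX : MeasurableSpace X} (μ : Measure X) (g : X → ℂ) (x : X) : ℂ :=
  (condER 𝒜 μ (fun y => (g y).re) x : ℂ) +
    (condER 𝒜 μ (fun y => (g y).im) x : ℂ) * Complex.I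

/-- The bounded operator `T` on `L²(μ)` is the weighted conditional expectation operator
`M_w E M_u`, that is, `T f = w E(u f)` a.e. for every `f ∈ L²(μ)`. -/
def IsWCE (𝒜 : MeasurableSpace X) {mX : MeasurableSpace X} (μ : Measure X)
    (w u : X → ℝ)
    (T : Lp ℂ 2 μ →L[ℂ] Lp ℂ 2 μ) : Prop :=
  ∀ f : Lp ℂ 2 μ, T f =ᵐ[μ] fun x => (w x : ℂ) * condE 𝒜 μ (fun y => (u y : ℂ) * f y) x

end CondExp

end WCE

end

/-! Since `E(uf)` is 𝒜-measurable, it pulls out of `E`, and `T²f = E(uw)·Tf`. So `T² = MT` with `M`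
a self-adjoint multiplication commuting with `T` (`IsWCE.exists_isSelfAdjoint_commute`); the rest is
operator theory. Let `Δ` be the Aluthge transform. Then `TΔ = T²` (`mul_aluthge`) and `Δ = U*|T|`
(`aluthge_eq_star_polarPart_mul`). Hence `Tⁿ⁺¹ = TΔⁿ`, which gives `‖Δⁿx‖ ≤ ‖Tⁿx‖` and `‖Tⁿ⁺¹x‖ ≤
‖T‖‖Δⁿx‖`. As `r(Δ) = r(T)`, both operators have the same `d_m`. Since `‖R_m x‖² = ∑ d_m²ⁿ‖Tⁿx‖²`,
and similarly for `Δ`, the norms `‖R_m(T)x‖` and `‖R_m(Δ)x‖` are equivalent with constants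
independent of `m`, once `r(T) > 0` bounds `d_m`. Uniformly equivalent norms define the same
algebra. -/

noncomputable section

namespace WCE

/-! ### The series defining `R_m`, and comparison of spectral radius algebras. -/

section Series

variable {H : Type*} [NormedAddCommGroup H] [InnerProductSpace ℂ H]

/-- By Gelfand's formula, `‖aⁿ‖ ≤ ρⁿ` eventually for any `ρ` strictly between `r(a)` and `1/d`;
compare with the geometric series of ratio `(dρ)²`. -/
theorem summable_mul_norm_pow_sq {A : Type*} [NormedRing A] [NormedAlgebra ℂ A] [CompleteSpace A]
    (a : A) {d : ℝ} (hd0 : 0 ≤ d) (hd : d * (spectralRadius ℂ a).toReal < 1) :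
    Summable fun n : ℕ => d ^ (2 * n) * ‖a ^ n‖ ^ 2 := by
  rcases hd0.eq_or_lt with rfl | hd0
  · refine summable_of_ne_finset_zero (s := {0}) fun n hn => ?_
    have : 2 * n ≠ 0 := by simpa using hn
    simp [this]
  have hfin : spectralRadius ℂ a ≠ ∞ :=
    ne_top_of_le_ne_top (by finiteness) (spectrum.spectralRadius_le_pow_nnnorm_pow_one_div ℂ a 0)
  obtain ⟨ρ, hρ, hρd⟩ : ∃ ρ, (spectralRadius ℂ a).toReal < ρ ∧ ρ < d⁻¹ :=
    exists_between (by rw [inv_eq_one_div, lt_div_iff₀ hd0]; linarith)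
  have hρ0 : 0 < ρ := ENNReal.toReal_nonneg.trans_lt hρ
  have hlt : spectralRadius ℂ a < ENNReal.ofReal ρ := by
    rwa [ENNReal.lt_ofReal_iff_toReal_lt hfin]
  have hev := (spectrum.pow_norm_pow_one_div_tendsto_nhds_spectralRadius a).eventually_lt_const hlt
  have hρd1 : d * ρ < 1 := by
    have := mul_lt_mul_of_pos_left hρd hd0
    rwa [mul_inv_cancel₀ hd0.ne'] at this
  refine Summable.of_norm_bounded_eventually_nat (g := fun n => ((d * ρ) ^ 2) ^ n)
    (summable_geometric_of_lt_one (by positivity) (pow_lt_one₀ (by positivity) hρd1 two_ne_zero)) ?_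
  filter_upwards [hev, Filter.eventually_gt_atTop 0] with n hn hn0
  rw [ENNReal.ofReal_lt_ofReal_iff hρ0] at hn
  have hle : ‖a ^ n‖ ≤ ρ ^ n := by
    have := pow_le_pow_left₀ (by positivity) hn.le n
    rwa [one_div, Real.rpow_inv_natCast_pow (norm_nonneg _) hn0.ne'] at this
  rw [Real.norm_of_nonneg (by positivity), ← pow_mul, mul_pow, pow_mul' ρ]
  gcongr

theorem dCoeff_nonneg (T : H →L[ℂ] H) (m : ℕ) : 0 ≤ dCoeff T m := by
  unfold dCoeff; positivity

theorem dCoeff_mul_spectralRadius_lt_one (T : H →L[ℂ] H) {m : ℕ} (hm : 1 ≤ m) :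
    dCoeff T m * (spectralRadius ℂ T).toReal < 1 := by
  have h1 : 0 < 1 / (m : ℝ) := by positivity
  have h2 : 0 ≤ (spectralRadius ℂ T).toReal := ENNReal.toReal_nonneg
  rw [dCoeff, one_div_mul_eq_div, div_lt_one (by positivity)]
  linarith

theorem dCoeff_le_inv (T : H →L[ℂ] H) (m : ℕ) (hT : 0 < (spectralRadius ℂ T).toReal) :
    dCoeff T m ≤ (spectralRadius ℂ T).toReal⁻¹ := by
  rw [dCoeff, one_div]
  gcongr
  simp

/-- `AQA⁻¹ = (AB⁻¹)(BQB⁻¹)(BA⁻¹)`, and the outer factors have norms at most `c₁` and `c₂`. -/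
theorem norm_conj_le_of_le {A B : H →L[ℂ] H} (hA : IsUnit A) (hB : IsUnit B) {c₁ c₂ : ℝ} (hc₁ : 0 ≤ c₁)
    (hc₂ : 0 ≤ c₂)
    (h₁ : ∀ x, ‖A x‖ ≤ c₁ * ‖B x‖) (h₂ : ∀ x, ‖B x‖ ≤ c₂ * ‖A x‖) (Q : H →L[ℂ] H) :
    ‖A * Q * Ring.inverse A‖ ≤ c₁ * c₂ * ‖B * Q * Ring.inverse B‖ := by
  refine ContinuousLinearMap.opNorm_le_bound _ (by positivity) fun x => ?_
  have hAx : A (Ring.inverse A x) = x := congrArg (· x) (Ring.mul_inverse_cancel A hA)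
  have hBx (y) : Ring.inverse B (B y) = y := congrArg (· y) (Ring.inverse_mul_cancel B hB)
  calc ‖A (Q (Ring.inverse A x))‖ ≤ c₁ * ‖B (Q (Ring.inverse A x))‖ := h₁ _
    _ = c₁ * ‖(B * Q * Ring.inverse B) (B (Ring.inverse A x))‖ := by simp [hBx]
    _ ≤ c₁ * (‖B * Q * Ring.inverse B‖ * (c₂ * ‖x‖)) := by
      gcongr
      refine (ContinuousLinearMap.le_opNorm _ _).trans ?_
      gcongr
      simpa only [hAx] using h₂ (Ring.inverse A x)
    _ = _ := by ring

variable [CompleteSpace H]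

theorem summable_dCoeff_smul (T : H →L[ℂ] H) {m : ℕ} (hm : 1 ≤ m) :
    Summable fun n : ℕ => ((dCoeff T m ^ (2 * n) : ℝ) : ℂ) • (star T ^ n * T ^ n) := by
  refine .of_norm_bounded (summable_mul_norm_pow_sq T (dCoeff_nonneg T m)
    (dCoeff_mul_spectralRadius_lt_one T hm)) fun n => ?_
  rw [norm_smul, Complex.norm_real,
    Real.norm_of_nonneg (pow_nonneg (dCoeff_nonneg T m) _), ← star_pow, CStarRing.norm_star_mul_self, sq]

theorem dCoeff_smul_nonneg (T : H →L[ℂ] H) (m n : ℕ) :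
    0 ≤ ((dCoeff T m ^ (2 * n) : ℝ) : ℂ) • (star T ^ n * T ^ n) := by
  rw [Complex.coe_smul, ← star_pow]
  exact smul_nonneg (pow_nonneg (dCoeff_nonneg T m) _) (star_mul_self_nonneg _)

theorem rOp_mul_self (T : H →L[ℂ] H) (m : ℕ) :
    rOp T m * rOp T m = ∑' n : ℕ, ((dCoeff T m ^ (2 * n) : ℝ) : ℂ) • (star T ^ n * T ^ n) :=
  CFC.sqrt_mul_sqrt_self _ (tsum_nonneg fun n => dCoeff_smul_nonneg T m n)

/-- The `n = 0` term of the series is the identity, so `R_m² ≥ 1`. -/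
theorem isUnit_rOp (T : H →L[ℂ] H) {m : ℕ} (hm : 1 ≤ m) : IsUnit (rOp T m) := by
  have h1 : (1 : H →L[ℂ] H) ≤ rOp T m * rOp T m := by
    rw [rOp_mul_self]
    have := (summable_dCoeff_smul T hm).le_tsum 0 fun n _ => dCoeff_smul_nonneg T m n
    simpa using this
  have h2 := CStarAlgebra.isUnit_of_le (1 : H →L[ℂ] H) h1 (IsUnit.isStrictlyPositive isUnit_one zero_le_one)
  exact ((Commute.refl _).isUnit_mul_iff.1 h2).1

theorem hasSum_norm_rOp_apply_sq (T : H →L[ℂ] H) {m : ℕ} (hm : 1 ≤ m) (x : H) :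
    HasSum (fun n : ℕ => dCoeff T m ^ (2 * n) * ‖(T ^ n) x‖ ^ 2) (‖rOp T m x‖ ^ 2) := by
  have h := (summable_dCoeff_smul T hm).hasSum
  rw [← rOp_mul_self] at h
  have hsa : star (rOp T m) = rOp T m := (IsSelfAdjoint.of_nonneg (CFC.sqrt_nonneg _)).star_eq
  have h2 := h.mapL (Complex.reCLM ∘L (innerSL ℂ x).restrictScalars ℝ ∘L
    (ContinuousLinearMap.apply ℂ H x).restrictScalars ℝ)
  convert h2 using 1
  · ext n
    rw [← star_pow, Complex.coe_smul, ContinuousLinearMap.star_eq_adjoint]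
    change _ = (inner ℂ x (dCoeff T m ^ (2 * n) •
      ContinuousLinearMap.adjoint (T ^ n) ((T ^ n) x)) : ℂ).re
    rw [inner_smul_right_eq_smul, ContinuousLinearMap.adjoint_inner_right, Complex.smul_re,
      inner_self_eq_norm_sq_to_K, smul_eq_mul]
    norm_cast
  · simp
    nth_rw 2 [← hsa]
    rw [ContinuousLinearMap.star_eq_adjoint, ContinuousLinearMap.adjoint_inner_right,
      inner_self_eq_norm_sq_to_K]
    norm_cast

theorem spectralRadiusAlgebra_eq_of_equiv {S T : H →L[ℂ] H} {c₁ c₂ : ℝ} (hc₁ : 0 ≤ c₁) (hc₂ : 0 ≤ c₂)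
    (h₁ : ∀ m, 1 ≤ m → ∀ x, ‖rOp S m x‖ ≤ c₁ * ‖rOp T m x‖)
    (h₂ : ∀ m, 1 ≤ m → ∀ x, ‖rOp T m x‖ ≤ c₂ * ‖rOp S m x‖) :
    spectralRadiusAlgebra S = spectralRadiusAlgebra T := by
  ext Q
  constructor
  · rintro ⟨C, hC⟩
    exact ⟨c₂ * c₁ * C, fun m hm => (norm_conj_le_of_le (isUnit_rOp T hm) (isUnit_rOp S hm)
      hc₂ hc₁ (h₂ m hm) (h₁ m hm) Q).trans (by gcongr; exact hC m hm)⟩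
  · rintro ⟨C, hC⟩
    exact ⟨c₁ * c₂ * C, fun m hm => (norm_conj_le_of_le (isUnit_rOp S hm) (isUnit_rOp T hm)
      hc₁ hc₂ (h₁ m hm) (h₂ m hm) Q).trans (by gcongr; exact hC m hm)⟩

end Series

/-! ### Polar decomposition, Aluthge transform and cancellation. -/

section Aluthge

variable {H : Type*} [NormedAddCommGroup H] [InnerProductSpace ℂ H] [CompleteSpace H]

theorem spectralRadius_mul_comm {A : Type*} [NormedRing A] [NormedAlgebra ℂ A] (a b : A) :
    spectralRadius ℂ (a * b) = spectralRadius ℂ (b * a) := by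
  have key (a b : A) : spectralRadius ℂ (a * b) ≤ spectralRadius ℂ (b * a) := by
    refine iSup₂_le fun k hk => ?_
    rcases eq_or_ne k 0 with rfl | hk0
    · simp
    · have : k ∈ spectrum ℂ (a * b) \ {0} := ⟨hk, hk0⟩
      rw [spectrum.nonzero_mul_comm] at this
      exact le_iSup₂ (f := fun k (_ : k ∈ spectrum ℂ (b * a)) => (‖k‖₊ : ℝ≥0∞)) k this.1
  exact le_antisymm (key a b) (key b a)

theorem sqrt_abs_mul_self (T : H →L[ℂ] H) :
    CFC.sqrt (CFC.abs T) * CFC.sqrt (CFC.abs T) = CFC.abs T :=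
  CFC.sqrt_mul_sqrt_self _ (CFC.abs_nonneg T)

/-- Cycling one factor `|T|^{1/2}` around the product turns it into `U|T| = T`. -/
theorem spectralRadius_aluthge (T : H →L[ℂ] H) :
    spectralRadius ℂ (aluthge T) = spectralRadius ℂ T := by
  rw [aluthge, mul_assoc, spectralRadius_mul_comm, mul_assoc, sqrt_abs_mul_self,
    ← (isPolarPart_polarPart T).eq_mul]

theorem norm_polarPart_le_one (T : H →L[ℂ] H) : ‖polarPart T‖ ≤ 1 := by
  set U := polarPart T
  set K := LinearMap.ker (U : H →ₗ[ℂ] H)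
  have hK : IsClosed (K : Set H) := U.isClosed_ker
  have : CompleteSpace K := hK.completeSpace_coe
  refine ContinuousLinearMap.opNorm_le_bound _ zero_le_one fun x => ?_
  obtain ⟨y, hy, z, hz, rfl⟩ := K.exists_add_mem_mem_orthogonal (v := x)
  have hUy : U y = 0 := hy
  rw [map_add, hUy, zero_add, one_mul, (isPolarPart_polarPart T).partial_isometry z hz]
  have h := norm_add_sq_eq_norm_sq_add_norm_sq_of_inner_eq_zero (𝕜 := ℂ) y z (hz y hy)
  nlinarith [norm_nonneg z, norm_nonneg (y + z), norm_nonneg y]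

/-- `X` vanishes on the range of `A` and on its orthogonal complement `ker A`. With `A = |T|`, this
reduces identities to a check on `ran |T|` and on `ker |T|`. -/
theorem eq_zero_of_mul_eq_zero_of_ker_le {A X : H →L[ℂ] H} (hA : IsSelfAdjoint A) (h : X * A = 0)
    (hker : ∀ x, A x = 0 → X x = 0) : X = 0 := by
  have h1 : A * star X = 0 := by
    rw [← star_eq_zero, star_mul, star_star, hA.star_eq, h]
  rw [← CStarRing.mul_star_self_eq_zero_iff]
  ext x
  exact hker _ (congrArg (· x) h1)

theorem mul_eq_zero_of_mul_self_mul_eq_zero {A X : H →L[ℂ] H} (hA : IsSelfAdjoint A)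
    (h : A * A * X = 0) : A * X = 0 := by
  rw [← CStarRing.star_mul_self_eq_zero_iff, star_mul, hA.star_eq, mul_assoc, ← mul_assoc A, h,
    mul_zero]

/-! ### Operators with `T² = MT`, `M` self-adjoint and commuting with `T`. -/

section Factor

variable {M T : H →L[ℂ] H}

theorem commute_star_of_isSelfAdjoint (hM : IsSelfAdjoint M) (hMT : Commute M T) : Commute M (star T) := by
  simpa [hM.star_eq] using hMT.star_star

theorem commute_sqrt_abs (hM : IsSelfAdjoint M) (hMT : Commute M T) :
    Commute M (CFC.sqrt (CFC.abs T)) := by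
  have h : Commute T M := hMT.symm
  exact ((h.cfcAbs_left (by rwa [hM.star_eq])).cfcₙ_nnreal _).symm

/-- `|T|²T = T*T² = T*MT = |T|²M`, and one factor `|T|` cancels. -/
theorem abs_mul_eq (hM : IsSelfAdjoint M) (hMT : Commute M T) (hT : T * T = M * T) :
    CFC.abs T * T = M * CFC.abs T := by
  have hMs := commute_star_of_isSelfAdjoint hM hMT
  have hMA : Commute M (CFC.abs T) := (hMT.symm.cfcAbs_left (by rw [hM.star_eq]; exact hMT.symm)).symm
  have hA : IsSelfAdjoint (CFC.abs T) := .of_nonneg (CFC.abs_nonneg T)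
  have hU := (isPolarPart_polarPart T).eq_mul
  have h := mul_eq_zero_of_mul_self_mul_eq_zero (X := polarPart T * CFC.abs T - M) hA (by
    rw [CFC.abs_mul_abs, mul_sub, ← hU, mul_assoc, hT, ← mul_assoc, ← hMs.eq, mul_assoc,
      (hMs.mul_right hMT).eq, sub_self])
  rw [← hU, mul_sub, sub_eq_zero] at h
  rw [h, hMA.eq]

theorem aluthge_mul_sqrt (hM : IsSelfAdjoint M) (hMT : Commute M T) (hT : T * T = M * T) :
    aluthge T * CFC.sqrt (CFC.abs T) = M * CFC.sqrt (CFC.abs T) := by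
  have hs : IsSelfAdjoint (CFC.sqrt (CFC.abs T)) := .of_nonneg (CFC.sqrt_nonneg _)
  have hMs := commute_sqrt_abs hM hMT
  have hss := sqrt_abs_mul_self T
  have hU := (isPolarPart_polarPart T).eq_mul
  have hAT := abs_mul_eq hM hMT hT
  have h := mul_eq_zero_of_mul_self_mul_eq_zero (X := T - M) hs (by
    rw [hss, mul_sub, hAT, ← hss, ← mul_assoc, hMs.eq, mul_assoc, hMs.eq, mul_assoc, sub_self])
  rw [mul_sub, sub_eq_zero] at h
  rw [aluthge, mul_assoc, mul_assoc, hss, ← hU, h, hMs.eq]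

theorem apply_eq_zero_of_abs {x : H} (hx : CFC.abs T x = 0) : T x = 0 := by
  rw [← norm_eq_zero, ← norm_abs_apply, hx, norm_zero]

theorem sqrt_abs_apply_eq_zero {x : H} (hx : CFC.abs T x = 0) : CFC.sqrt (CFC.abs T) x = 0 := by
  have hs : IsSelfAdjoint (CFC.sqrt (CFC.abs T)) := .of_nonneg (CFC.sqrt_nonneg _)
  have : (inner ℂ (CFC.sqrt (CFC.abs T) x) (CFC.sqrt (CFC.abs T) x) : ℂ) = 0 := by
    rw [← ContinuousLinearMap.adjoint_inner_right, hs.adjoint_eq, ← mul_apply_eq_comp,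
      sqrt_abs_mul_self, hx, inner_zero_right]
  exact inner_self_eq_zero.1 this

theorem aluthge_apply_eq_zero {x : H} (hx : CFC.abs T x = 0) : aluthge T x = 0 := by
  simp [aluthge, sqrt_abs_apply_eq_zero hx]

theorem aluthge_mul_abs (hM : IsSelfAdjoint M) (hMT : Commute M T) (hT : T * T = M * T) :
    aluthge T * CFC.abs T = M * CFC.abs T := by
  rw [← sqrt_abs_mul_self T, ← mul_assoc, aluthge_mul_sqrt hM hMT hT, mul_assoc]

theorem mul_aluthge (hM : IsSelfAdjoint M) (hMT : Commute M T) (hT : T * T = M * T) :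
    T * aluthge T = T * T := by
  have hA : IsSelfAdjoint (CFC.abs T) := .of_nonneg (CFC.abs_nonneg T)
  rw [← sub_eq_zero]
  refine eq_zero_of_mul_eq_zero_of_ker_le hA ?_ fun x hx => ?_
  · rw [sub_mul, mul_assoc, aluthge_mul_abs hM hMT hT, hT, hMT.eq, mul_assoc, sub_self]
  · simp [aluthge_apply_eq_zero hx, apply_eq_zero_of_abs hx]

/-- With `|T|` on the right, the estimate `‖Δx‖ ≤ ‖|T|x‖ = ‖Tx‖` is immediate. Combined with the
intermediate identity `Δ = |T|U`, it says that `Δ` is self-adjoint. -/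
theorem aluthge_eq_star_polarPart_mul (hM : IsSelfAdjoint M) (hMT : Commute M T)
    (hT : T * T = M * T) : aluthge T = star (polarPart T) * CFC.abs T := by
  have hA : IsSelfAdjoint (CFC.abs T) := .of_nonneg (CFC.abs_nonneg T)
  have hU := isPolarPart_polarPart T
  have h1 : aluthge T = CFC.abs T * polarPart T := by
    rw [← sub_eq_zero]
    refine eq_zero_of_mul_eq_zero_of_ker_le hA ?_ fun x hx => ?_
    · rw [sub_mul, aluthge_mul_abs hM hMT hT, mul_assoc, ← hU.eq_mul, abs_mul_eq hM hMT hT, sub_self]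
    · have hUx : polarPart T x = 0 := by
        have : x ∈ LinearMap.ker (polarPart T : H →ₗ[ℂ] H) := by rw [hU.ker_eq]; exact hx
        exact this
      simp [aluthge_apply_eq_zero hx, hUx]
  have h2 : CFC.abs T * aluthge T = CFC.abs T * M := by
    have := mul_eq_zero_of_mul_self_mul_eq_zero (X := aluthge T - M) hA (by
      rw [CFC.abs_mul_abs, mul_assoc, mul_sub, mul_aluthge hM hMT hT, hT, hMT.eq, sub_self, mul_zero])
    rwa [mul_sub, sub_eq_zero] at this
  rw [← sub_eq_zero]
  refine eq_zero_of_mul_eq_zero_of_ker_le hA ?_ fun x hx => ?_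
  -- The adjoint of `|T|Δ = |T|M`, with `Δ = |T|U`, reads `U*|T|² = M|T|`, which is also `Δ|T|`.
  · have h3 := congrArg star h2
    rw [h1, star_mul, star_mul, star_mul, hA.star_eq, hM.star_eq] at h3
    rw [sub_mul, h3, aluthge_mul_abs hM hMT hT, sub_self]
  · simp [aluthge_apply_eq_zero hx, hx]

theorem norm_aluthge_apply_le (hM : IsSelfAdjoint M) (hMT : Commute M T) (hT : T * T = M * T)
    (x : H) : ‖aluthge T x‖ ≤ ‖T x‖ := by
  rw [aluthge_eq_star_polarPart_mul hM hMT hT, ← norm_abs_apply T]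
  refine (ContinuousLinearMap.le_opNorm (star (polarPart T)) (CFC.abs T x)).trans ?_
  rw [norm_star]
  exact mul_le_of_le_one_left (norm_nonneg _) (norm_polarPart_le_one T)

theorem mul_aluthge_pow (hM : IsSelfAdjoint M) (hMT : Commute M T) (hT : T * T = M * T) (n : ℕ) :
    T * aluthge T ^ n = T ^ (n + 1) := by
  induction n with
  | zero => simp
  | succ n ih =>
    rw [pow_succ' (aluthge T), ← mul_assoc, mul_aluthge hM hMT hT, mul_assoc, ih, ← pow_succ']

theorem norm_aluthge_pow_apply_le (hM : IsSelfAdjoint M) (hMT : Commute M T) (hT : T * T = M * T)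
    (n : ℕ) (x : H) : ‖(aluthge T ^ n) x‖ ≤ ‖(T ^ n) x‖ := by
  cases n with
  | zero => simp
  | succ n =>
    rw [← mul_aluthge_pow hM hMT hT, pow_succ']
    exact norm_aluthge_apply_le hM hMT hT _

theorem norm_pow_succ_apply_le (hM : IsSelfAdjoint M) (hMT : Commute M T) (hT : T * T = M * T)
    (n : ℕ) (x : H) : ‖(T ^ (n + 1)) x‖ ≤ ‖T‖ * ‖(aluthge T ^ n) x‖ := by
  rw [← mul_aluthge_pow hM hMT hT]
  exact T.le_opNorm _

theorem aluthge_zero : aluthge (0 : H →L[ℂ] H) = 0 := by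
  ext x
  exact aluthge_apply_eq_zero (by simp)

theorem dCoeff_aluthge (T : H →L[ℂ] H) (m : ℕ) : dCoeff (aluthge T) m = dCoeff T m := by
  rw [dCoeff, dCoeff, spectralRadius_aluthge]

/-- An operator satisfying `T² = MT` for a self-adjoint `M` commuting with `T`
has the same spectral radius algebra as its Aluthge transform. -/
theorem spectralRadiusAlgebra_aluthge (hM : IsSelfAdjoint M) (hMT : Commute M T)
    (hT : T * T = M * T) (hr : T ≠ 0 → 0 < spectralRadius ℂ T) :
    spectralRadiusAlgebra T = spectralRadiusAlgebra (aluthge T) := by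
  by_cases hT0 : T = 0
  · rw [hT0, aluthge_zero]
  have hfin : spectralRadius ℂ T ≠ ∞ :=
    ne_top_of_le_ne_top (by finiteness) (spectrum.spectralRadius_le_pow_nnnorm_pow_one_div ℂ T 0)
  have hr' : 0 < (spectralRadius ℂ T).toReal := ENNReal.toReal_pos (hr hT0).ne' hfin
  set r := (spectralRadius ℂ T).toReal
  -- The `1` pays for the `n = 0` term `‖x‖²`; `(‖T‖/r)²` pays for the shifted tail, as `d_m ≤ 1/r`
  -- for every `m`.
  set c := Real.sqrt (1 + (r⁻¹ * ‖T‖) ^ 2)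
  refine spectralRadiusAlgebra_eq_of_equiv (c₁ := c) (c₂ := 1) (by positivity) zero_le_one ?_ ?_
  · intro m hm x
    have hS := hasSum_norm_rOp_apply_sq T hm x
    have hS' := hasSum_norm_rOp_apply_sq (aluthge T) hm x
    rw [dCoeff_aluthge] at hS'
    have hd0 := dCoeff_nonneg T m
    have hd := dCoeff_le_inv T m hr'
    have hx : ‖x‖ ^ 2 ≤ ‖rOp (aluthge T) m x‖ ^ 2 := by
      simpa using le_hasSum hS' 0 fun n _ => by positivity
    have hS1 := (hasSum_nat_add_iff' 1).2 hS
    have h2 := hasSum_le (fun n => ?_) hS1 (hS'.mul_left ((r⁻¹ * ‖T‖) ^ 2))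
    · refine abs_le_of_sq_le_sq' ?_ (by positivity) |>.2
      rw [mul_pow, Real.sq_sqrt (by positivity)]
      simp at h2
      linarith
    · calc dCoeff T m ^ (2 * (n + 1)) * ‖(T ^ (n + 1)) x‖ ^ 2
          ≤ dCoeff T m ^ (2 * (n + 1)) * (‖T‖ * ‖(aluthge T ^ n) x‖) ^ 2 := by
            gcongr; exact norm_pow_succ_apply_le hM hMT hT n x
        _ = (dCoeff T m * ‖T‖) ^ 2 * (dCoeff T m ^ (2 * n) * ‖(aluthge T ^ n) x‖ ^ 2) := by ring
        _ ≤ _ := by gcongr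
  · intro m hm x
    have hS := hasSum_norm_rOp_apply_sq T hm x
    have hS' := hasSum_norm_rOp_apply_sq (aluthge T) hm x
    rw [dCoeff_aluthge] at hS'
    rw [one_mul]
    refine abs_le_of_sq_le_sq' (hasSum_le (fun n => ?_) hS' hS) (norm_nonneg _) |>.2
    have hd0 := dCoeff_nonneg T m
    gcongr
    exact norm_aluthge_pow_apply_le hM hMT hT n x

end Factor
end Aluthge

/-! ### Pulling 𝒜-measurable factors out of the conditional expectation. -/

section CondExpPullOut

variable {X : Type*}

/-- The measures with densities `g` and `E(g)` agree on 𝒜, hence give `1ₛk` the same integral for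
every 𝒜-measurable set `s`. -/
theorem condLExp_mul_of_measurable_left {𝒜 mX : MeasurableSpace X} (h𝒜 : 𝒜 ≤ mX) (μ : Measure X)
    [SigmaFinite (μ.trim h𝒜)] {k g : X → ℝ≥0∞} (hk : Measurable[𝒜] k) (hg : AEMeasurable g μ) :
    condLExp 𝒜 μ (fun x => k x * g x) =ᵐ[μ] fun x => k x * condLExp 𝒜 μ g x := by
  have hk' : Measurable k := hk.mono h𝒜 le_rfl
  refine (ae_eq_condLExp h𝒜 μ _ (hk.mul (measurable_condLExp _ _ _)) fun s hs => ?_).symm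
  have htrim : (μ.withDensity (condLExp 𝒜 μ g)).trim h𝒜 = (μ.withDensity g).trim h𝒜 := by
    refine @Measure.ext _ 𝒜 _ _ fun t ht => ?_
    rw [trim_measurableSet_eq h𝒜 ht, trim_measurableSet_eq h𝒜 ht, withDensity_apply _ (h𝒜 t ht),
      withDensity_apply _ (h𝒜 t ht), setLIntegral_condLExp h𝒜 μ g ht]
  have key (f : X → ℝ≥0∞) (hf : AEMeasurable f μ) :
      ∫⁻ x in s, k x * f x ∂μ = ∫⁻ x, s.indicator k x ∂(μ.withDensity f).trim h𝒜 := by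
    rw [lintegral_trim h𝒜 (hk.indicator hs),
      lintegral_withDensity_eq_lintegral_mul₀ hf (hk'.indicator (h𝒜 s hs)).aemeasurable,
      ← lintegral_indicator (h𝒜 s hs)]
    congr with x
    by_cases hx : x ∈ s <;> simp [hx, mul_comm]
  exact (key _ (measurable_condLExp' _ _ _).aemeasurable).trans (htrim ▸ (key g hg).symm)

theorem condER_congr_ae {𝒜 mX : MeasurableSpace X} {μ : Measure X} {g g' : X → ℝ} (h : g =ᵐ[μ] g') :
    condER 𝒜 μ g =ᵐ[μ] condER 𝒜 μ g' := by
  filter_upwards [condLExp_congr_ae (mΩ := 𝒜) (h.fun_comp ENNReal.ofReal),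
    condLExp_congr_ae (mΩ := 𝒜) (h.fun_comp fun y => ENNReal.ofReal (-y))] with x h1 h2
  exact congrArg₂ (fun a b : ℝ≥0∞ => a.toReal - b.toReal) h1 h2

theorem measurable_condER {𝒜 mX : MeasurableSpace X} (μ : Measure X) (g : X → ℝ) :
    Measurable[𝒜] (condER 𝒜 μ g) :=
  (measurable_condLExp 𝒜 μ _).ennreal_toReal.sub (measurable_condLExp 𝒜 μ _).ennreal_toReal

/-- Uses `(kg)⁺ = k⁺g⁺ + k⁻g⁻`. No integrability is needed: at each point only one of `k⁺`, `k⁻` can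
be nonzero, and `toReal` is multiplicative even at `∞`. -/
theorem condER_mul_of_measurable_left {𝒜 mX : MeasurableSpace X} (h𝒜 : 𝒜 ≤ mX) (μ : Measure X)
    [SigmaFinite (μ.trim h𝒜)] {k g : X → ℝ} (hk : Measurable[𝒜] k) (hg : AEMeasurable g μ) :
    condER 𝒜 μ (fun x => k x * g x) =ᵐ[μ] fun x => k x * condER 𝒜 μ g x := by
  have hk' : Measurable k := hk.mono h𝒜 le_rfl
  have hpos : Measurable[𝒜] fun x => ENNReal.ofReal (k x) := hk.ennreal_ofReal
  have hneg : Measurable[𝒜] fun x => ENNReal.ofReal (-k x) := hk.neg.ennreal_ofReal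
  have split (g : X → ℝ) (hg : AEMeasurable g μ) :
      condLExp 𝒜 μ (fun x => ENNReal.ofReal (k x * g x)) =ᵐ[μ] fun x =>
        ENNReal.ofReal (k x) * condLExp 𝒜 μ (fun y => ENNReal.ofReal (g y)) x +
          ENNReal.ofReal (-k x) * condLExp 𝒜 μ (fun y => ENNReal.ofReal (-g y)) x := by
    have e : (fun x => ENNReal.ofReal (k x * g x)) =
        (fun x => ENNReal.ofReal (k x) * ENNReal.ofReal (g x)) +
          fun x => ENNReal.ofReal (-k x) * ENNReal.ofReal (-g x) := by
      ext x
      rcases le_total 0 (k x) with h | h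
      · simp [ENNReal.ofReal_mul h, ENNReal.ofReal_of_nonpos (neg_nonpos.2 h)]
      · simp [← ENNReal.ofReal_mul (neg_nonneg.2 h), ENNReal.ofReal_of_nonpos h]
    rw [e]
    filter_upwards [condLExp_add_left (mΩ := 𝒜) (P := μ)
        (fun x => ENNReal.ofReal (-k x) * ENNReal.ofReal (-g x))
        (hk'.ennreal_ofReal.aemeasurable.mul hg.ennreal_ofReal),
      condLExp_mul_of_measurable_left h𝒜 μ hpos hg.ennreal_ofReal,
      condLExp_mul_of_measurable_left h𝒜 μ hneg hg.neg.ennreal_ofReal] with x h1 h2 h3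
    exact h1.trans (congrArg₂ (· + ·) h2 h3)
  filter_upwards [split g hg, split (fun x => -g x) hg.neg] with x h1 h2
  simp only [condER, ← mul_neg, h1, h2, neg_neg]
  rcases le_total 0 (k x) with h | h
  · simp [ENNReal.ofReal_of_nonpos (neg_nonpos.2 h), h, mul_sub]
  · simp [ENNReal.ofReal_of_nonpos h, ENNReal.toReal_ofReal (neg_nonneg.2 h)]
    ring

theorem condE_congr_ae {𝒜 mX : MeasurableSpace X} {μ : Measure X} {g g' : X → ℂ} (h : g =ᵐ[μ] g') :
    condE 𝒜 μ g =ᵐ[μ] condE 𝒜 μ g' := by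
  filter_upwards [condER_congr_ae (𝒜 := 𝒜) (h.fun_comp Complex.re),
    condER_congr_ae (𝒜 := 𝒜) (h.fun_comp Complex.im)] with x h1 h2
  exact congrArg₂ (fun a b : ℝ => (a : ℂ) + b * Complex.I) h1 h2

theorem condE_ofReal_mul {𝒜 mX : MeasurableSpace X} (h𝒜 : 𝒜 ≤ mX) (μ : Measure X)
    [SigmaFinite (μ.trim h𝒜)] {k : X → ℝ} {g : X → ℂ} (hk : Measurable[𝒜] k)
    (hg : AEMeasurable g μ) :
    condE 𝒜 μ (fun x => (k x : ℂ) * g x) =ᵐ[μ] fun x => (k x : ℂ) * condE 𝒜 μ g x := by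
  filter_upwards [condER_mul_of_measurable_left h𝒜 μ hk (Complex.measurable_re.comp_aemeasurable hg),
    condER_mul_of_measurable_left h𝒜 μ hk (Complex.measurable_im.comp_aemeasurable hg)] with x h1 h2
  simp only [condE, Complex.re_ofReal_mul, Complex.im_ofReal_mul]
  simp only [Function.comp_apply] at h1 h2
  rw [h1, h2]
  simp only [Function.comp_def]
  push_cast
  ring

theorem condE_mul_ofReal {𝒜 mX : MeasurableSpace X} (h𝒜 : 𝒜 ≤ mX) (μ : Measure X)
    [SigmaFinite (μ.trim h𝒜)] {k : X → ℂ} {g : X → ℝ} (hk : Measurable[𝒜] k)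
    (hg : AEMeasurable g μ) :
    condE 𝒜 μ (fun x => k x * (g x : ℂ)) =ᵐ[μ] fun x => k x * (condER 𝒜 μ g x : ℂ) := by
  filter_upwards [condER_mul_of_measurable_left h𝒜 μ (Complex.measurable_re.comp hk) hg,
    condER_mul_of_measurable_left h𝒜 μ (Complex.measurable_im.comp hk) hg] with x h1 h2
  simp only [condE, Complex.re_mul_ofReal, Complex.im_mul_ofReal]
  simp only [Function.comp_apply] at h1 h2
  rw [h1, h2]
  nth_rw 3 [← Complex.re_add_im (k x)]
  push_cast
  ring

theorem measurable_condE {𝒜 mX : MeasurableSpace X} (μ : Measure X) (g : X → ℂ) :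
    Measurable[𝒜] (condE 𝒜 μ g) :=
  (Complex.measurable_ofReal.comp (measurable_condER μ _)).add
    ((Complex.measurable_ofReal.comp (measurable_condER μ _)).mul_const _)

end CondExpPullOut

/-! ### Multiplication by a bounded real function on `L²`. -/

section Multiplication

variable {X : Type*} {mX : MeasurableSpace X} {μ : Measure X}

theorem exists_isSelfAdjoint_multiplication {ψ : X → ℝ} (hψ : Measurable ψ) {C : ℝ}
    (hC : ∀ x, |ψ x| ≤ C) :
    ∃ M : Lp ℂ 2 μ →L[ℂ] Lp ℂ 2 μ, IsSelfAdjoint M ∧ ∀ f, M f =ᵐ[μ] fun x => (ψ x : ℂ) * f x := by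
  have hmem : MemLp (fun x => (ψ x : ℂ)) ∞ μ :=
    memLp_top_of_bound (Complex.measurable_ofReal.comp hψ).aestronglyMeasurable C
      (.of_forall fun x => by simpa using hC x)
  let M : Lp ℂ 2 μ →L[ℂ] Lp ℂ 2 μ :=
    (ContinuousLinearMap.mul ℂ ℂ).holderL μ ∞ 2 2 (hmem.toLp _)
  have hM (f) : M f =ᵐ[μ] fun x => (ψ x : ℂ) * f x := by
    filter_upwards [ContinuousLinearMap.coeFn_holder (r := 2) (ContinuousLinearMap.mul ℂ ℂ) (hmem.toLp _) f,
      hmem.coeFn_toLp] with x h1 h2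
    refine h1.trans ?_
    rw [h2]; rfl
  refine ⟨M, ContinuousLinearMap.isSelfAdjoint_iff_isSymmetric.2 fun f g => ?_, hM⟩
  simp only [ContinuousLinearMap.coe_coe, L2.inner_def]
  refine integral_congr_ae ?_
  filter_upwards [hM f, hM g] with x h1 h2
  simp only [h1, h2, RCLike.inner_apply, map_mul, Complex.conj_ofReal]
  ring

end Multiplication

/-! ### The identity `T² = MT` for weighted conditional expectations. -/

section WeightedCondExp

variable {X : Type*} {𝒜 mX : MeasurableSpace X} {μ : Measure X} {w u : X → ℝ}
  {T : Lp ℂ 2 μ →L[ℂ] Lp ℂ 2 μ}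

theorem IsWCE.apply_apply (h𝒜 : 𝒜 ≤ mX) [SigmaFinite (μ.trim h𝒜)] (hw : Measurable w)
    (hu : Measurable u) (hT : IsWCE 𝒜 μ w u T) (f : Lp ℂ 2 μ) :
    T (T f) =ᵐ[μ] fun x => (condER 𝒜 μ (fun y => u y * w y) x : ℂ) * T f x := by
  set k := condE 𝒜 μ fun y => (u y : ℂ) * f y
  have h1 : (fun y => (u y : ℂ) * T f y) =ᵐ[μ] fun y => k y * ((u y * w y : ℝ) : ℂ) := by
    filter_upwards [hT f] with y hy
    rw [hy]
    push_cast
    ring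
  filter_upwards [hT (T f), hT f, condE_congr_ae (𝒜 := 𝒜) h1,
    condE_mul_ofReal h𝒜 μ (measurable_condE μ _ : Measurable[𝒜] k)
      (g := fun y => u y * w y) (hu.mul hw).aemeasurable] with x h2 h3 h4 h5
  rw [h2, h4, h3]
  refine (congrArg _ h5).trans ?_
  ring

theorem IsWCE.apply_multiplication (h𝒜 : 𝒜 ≤ mX) [SigmaFinite (μ.trim h𝒜)]
    (hu : Measurable u) (hT : IsWCE 𝒜 μ w u T) {ψ : X → ℝ} (hψ : Measurable[𝒜] ψ) {f g : Lp ℂ 2 μ}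
    (hg : g =ᵐ[μ] fun x => (ψ x : ℂ) * f x) :
    T g =ᵐ[μ] fun x => (ψ x : ℂ) * T f x := by
  have h1 : (fun y => (u y : ℂ) * g y) =ᵐ[μ] fun y => (ψ y : ℂ) * ((u y : ℂ) * f y) := by
    filter_upwards [hg] with y hy
    rw [hy]
    ring
  filter_upwards [hT g, hT f, condE_congr_ae (𝒜 := 𝒜) h1,
    condE_ofReal_mul h𝒜 μ hψ ((Complex.measurable_ofReal.comp hu).aemeasurable.mul
      (Lp.aestronglyMeasurable f).aemeasurable)] with x h2 h3 h4 h5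
  rw [h2, h4, h3]
  refine (congrArg _ h5).trans ?_
  simp only [Function.comp_def, Pi.mul_def]
  ring

/-- A bounded weighted conditional expectation operator `T` satisfies `T² = MT`, with `M` the
multiplication by a bounded truncation of `E(uw)`. -/
theorem IsWCE.exists_isSelfAdjoint_commute (h𝒜 : 𝒜 ≤ mX) [SigmaFinite (μ.trim h𝒜)]
    (hw : Measurable w) (hu : Measurable u) (hT : IsWCE 𝒜 μ w u T) :
    ∃ M : Lp ℂ 2 μ →L[ℂ] Lp ℂ 2 μ, IsSelfAdjoint M ∧ Commute M T ∧ T * T = M * T := by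
  set h : X → ℝ := condER 𝒜 μ fun y => u y * w y
  have hh : Measurable[𝒜] h := measurable_condER μ _
  -- Any level above `‖T‖` works: on `B`, where `|E(uw)| > N`, every `Tf` turns out to vanish, so
  -- replacing `E(uw)` by `0` there changes nothing.
  set N := ‖T‖ + 1
  have hN : 0 < N := by positivity
  set B : Set X := {x | N < |h x|}
  have hB : MeasurableSet[𝒜] B :=
    (continuous_abs.measurable.comp hh) measurableSet_Ioi
  set χ : X → ℝ := B.indicator fun _ => 1
  have hχ : Measurable[𝒜] χ :=
    (@measurable_const ℝ X _ 𝒜 1).indicator hB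
  set ψ : X → ℝ := Bᶜ.indicator h
  have hψ : Measurable[𝒜] ψ := hh.indicator hB.compl
  obtain ⟨P, -, hP⟩ := exists_isSelfAdjoint_multiplication (μ := μ) (hχ.mono h𝒜 le_rfl) (C := 1)
    fun x => by by_cases hx : x ∈ B <;> simp [χ, hx]
  obtain ⟨M, hMsa, hM⟩ := exists_isSelfAdjoint_multiplication (μ := μ) (hψ.mono h𝒜 le_rfl) (C := N)
    fun x => by
      by_cases hx : x ∈ B
      · simpa [ψ, hx] using hN.le
      · simpa [ψ, hx] using not_lt.1 hx
  -- `T(Pf) = χ·Tf` lives on `B`, where `T` multiplies it by `E(uw)`. So `N‖TPf‖ ≤ ‖T(TPf)‖ ≤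
  -- ‖T‖‖TPf‖`, forcing `TPf = 0`.
  have hTP (f) : T (P f) = 0 := by
    have h1 := hT.apply_multiplication h𝒜 hu hχ (hP f)
    have h2 : ‖(N : ℂ) • T (P f)‖ ≤ ‖T (T (P f))‖ := by
      refine Lp.norm_le_norm_of_ae_le ?_
      filter_upwards [Lp.coeFn_smul (N : ℂ) (T (P f)), h1, hT.apply_apply h𝒜 hw hu (P f)]
        with x h3 h4 h5
      rw [h3, h5, Pi.smul_apply, smul_eq_mul, norm_mul, norm_mul, Complex.norm_real,
        Complex.norm_real, Real.norm_of_nonneg hN.le]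
      by_cases hx : x ∈ B
      · gcongr
        exact le_of_lt hx
      · simp [h4, χ, hx]
    rw [norm_smul, Complex.norm_real, Real.norm_of_nonneg hN.le] at h2
    have h6 := h2.trans (T.le_opNorm _)
    rw [← norm_le_zero_iff]
    simp only [N] at h6
    linarith
  refine ⟨M, hMsa, ?_, ?_⟩
  · refine ContinuousLinearMap.ext fun f => Lp.ext ?_
    exact (hM (T f)).trans (hT.apply_multiplication h𝒜 hu hψ (hM f)).symm
  · refine ContinuousLinearMap.ext fun f => Lp.ext ?_
    have h0 : T (P f) =ᵐ[μ] 0 := by rw [hTP]; exact Lp.coeFn_zero _ _ _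
    filter_upwards [hM (T f), hT.apply_apply h𝒜 hw hu f, h0,
      hT.apply_multiplication h𝒜 hu hχ (hP f)] with x h1 h2 h3 h4
    refine h2.trans (Eq.trans ?_ h1.symm)
    by_cases hx : x ∈ B
    · have : T f x = 0 := by simpa [χ, hx, h3] using h4.symm
      simp [this]
    · simp [ψ, hx, h]

end WeightedCondExp
end WCE
end

theorem mainTheorem4 {X : Type*} (𝒜 : MeasurableSpace X) {mX : MeasurableSpace X}
    (μ : Measure X) (h𝒜 : 𝒜 ≤ mX) [SigmaFinite (μ.trim h𝒜)]
    (w u : X → ℝ) (hw : Measurable w) (hu : Measurable u)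
    (hw0 : 0 ≤ᵐ[μ] w) (hu0 : 0 ≤ᵐ[μ] u)
    (hu2 : essSup (condLExp 𝒜 μ (fun x => ENNReal.ofReal (u x ^ 2))) μ < ∞)
    (T : Lp ℂ 2 μ →L[ℂ] Lp ℂ 2 μ) (hT : WCE.IsWCE 𝒜 μ w u T)
    (hr : T ≠ 0 → 0 < spectralRadius ℂ T) :
    WCE.spectralRadiusAlgebra T = WCE.spectralRadiusAlgebra (WCE.aluthge T) := by
  obtain ⟨M, hM, hMT, hTT⟩ := hT.exists_isSelfAdjoint_commute h𝒜 hw hu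
  exact WCE.spectralRadiusAlgebra_aluthge hM hMT hTT hr
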